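/- Let $R$ be a commutative ring and let $G$ be a finite directed graph with vertex set $V$ and edge set $E\subseteq V\times V$ that is connected (as an undirected graph, i.e. forgetting the directions of the edges). For vertices $x,y$ let $d(x,y)\in\mathbb{N}\cup\{\infty\}$ be the minimal number of edges of a directed path from $x$ to $y$ (the constant path included), and put $\mathrm{len}(x_0,\dots,x_k)=\sum_{i=0}^{k-1}d(x_i,x_{i+1})$. Write $\partial_i$ for the operation of forgetting the $i$-th entry of a tuple. For $k,\ell\ge 0$ let $\mathrm{EMC}_{k,\ell}(G)$ be the free $R$-module on the tuples $(x_0,\dots,x_k)$ of pairwise distinct vertices with $\mathrm{len}(x_0,\dots,x_k)=\ell$, with differential $\sum_{i=1}^{k-1}(-1)^i\partial_i$, where a face whose length is not $\ell$ is replaced by $0$; let $\mathrm{EMH}_{k,\ell}(G)=H_k(\mathrm{EMC}_{*,\ell}(G))$ be the eulerian magnitude homology of $G$. Assume that $G$ is regularly diagonal over $R$, i.e. $\mathrm{EMH}_{k,\ell}(G)=0$ for all $k\ne\ell$. Let $\mathcal{A}^\iota_n(G)$ be the free $R$-module on the tuples $(x_0,\dots,x_n)$ of pairwise distinct vertices with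 $(x_i,x_{i+1})\in E$ for all $i<n$, let $\partial=\sum_{i=0}^{n}(-1)^i\partial_i$, and let $\Omega^\iota_n(G)=\{a\in\mathcal{A}^\iota_n(G) : \partial a\in\mathcal{A}^\iota_{n-1}(G)\}$ (with $\Omega^\iota_0(G)=\mathcal{A}^\iota_0(G)$). The regular path homology of $G$ is the homology of the chain complex $(\Omega^\iota_*(G),\partial)$. Let $\mathrm{Inj}(G)$ be the complex of injective words on $G$: its $n$-simplices are the tuples $(x_0,\dots,x_n)$ of pairwise distinct vertices such that for all $i<j$ there is a directed path in $G$ from $x_i$ to $x_j$, with faces $\partial_i$. Let $\mathrm{Pre}(G)$ be the reachability preorder of $G$, i.e. the directed graph on $V$ with an edge $(x,y)$ whenever there is a (possibly constant) directed path from $x$ to $y$ in $G$; and for a directed graph $H$ let $\mathrm{dFl}(H)$ be its directed flag complex, whose $n$-simplices are the tuples $(x_0,\dots,x_n)$ of pairwise distinct vertices such that $(x_i,x_j)$ is an edge of $H$ for all $i<j$. The homology of these complexes with coefficients in $R$ is that of the free modules on the $n$-simplices with differential $\sum_{i=0}^n(-1)^i\partial_i$. Then for every $n\ge 0$ there are isomorphisms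 of $R$-modules $$H_n(\Omega^\iota_*(G),\partial)\;\cong\; H_n(\mathrm{Inj}(G);R)\qquad\text{and}\qquad H_n(\Omega^\iota_*(G),\partial)\;\cong\; H_n(\mathrm{dFl}(\mathrm{Pre}(G));R).$$ -/

import Mathlib

open CategoryTheory

namespace EulerianMagnitude

universe u v

section Chains

variable (R : Type u) [CommRing R] {V : Type v}

/-- The `i`-th face of a tuple `(x_0, …, x_{n+1})`: forget the `i`-th entry. -/
def face {n : ℕ} (i : Fin (n + 2)) (x : Fin (n + 2) → V) : Fin (n + 1) → V :=
  fun j => x (i.succAbove j)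

variable (V) in
/-- The free `R`-module on the tuples `(x_0, …, x_n)` of elements of `V`
(the elementary `n`-paths). -/
abbrev Tuples (n : ℕ) : Type max u v := (Fin (n + 1) → V) →₀ R

/-- The signed sum `∑_{i ∈ s} (-1)^i ∂_i` of the face maps with index in `s`. -/
noncomputable def signedFaces {n : ℕ} (s : Finset (Fin (n + 2))) :
    Tuples R V (n + 1) →ₗ[R] Tuples R V n :=
  Finsupp.linearCombination R fun x : Fin (n + 2) → V =>
    ∑ i ∈ s, (-1 : R) ^ (i : ℕ) • Finsupp.single (face i x) (1 : R)

/-- The differential `∂ = ∑_{i=0}^{n+1} (-1)^i ∂_i` on elementary paths. -/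
noncomputable def boundary (n : ℕ) : Tuples R V (n + 1) →ₗ[R] Tuples R V n :=
  signedFaces R Finset.univ

lemma signedFaces_single {n : ℕ} (s : Finset (Fin (n + 2))) (x : Fin (n + 2) → V) :
    signedFaces R s (Finsupp.single x 1) =
      ∑ i ∈ s, (-1 : R) ^ (i : ℕ) • Finsupp.single (face i x) (1 : R) := by
  simp [signedFaces]

lemma boundary_boundary (n : ℕ) (a : Tuples R V (n + 2)) :
    boundary R n (boundary R (n + 1) a) = 0 := by
  suffices h : boundary R n ∘ₗ boundary R (n + 1) = (0 : Tuples R V (n + 2) →ₗ[R] _) from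
    LinearMap.congr_fun h a
  refine Finsupp.lhom_ext' fun x => LinearMap.ext_ring ?_
  simp only [LinearMap.comp_apply, Finsupp.lsingle_apply, LinearMap.zero_apply, boundary,
    signedFaces_single, map_sum, map_smul, Finset.smul_sum, smul_smul]
  rw [← Finset.sum_product']
  refine Finset.sum_involution (fun p _ => (p.1.succAbove p.2, p.2.predAbove p.1)) ?_ ?_ ?_ ?_
  · rintro ⟨i, j⟩ -
    have hf : face (j.predAbove i) (face (i.succAbove j) x) = face j (face i x) := by
      funext k
      exact congrArg x (Fin.succAbove_succAbove_succAbove_predAbove i j k)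
    have hs := Fin.neg_one_pow_succAbove_add_predAbove (R := R) i j
    simp only [hf, ← pow_add, ← add_smul]
    rw [hs]
    simp
  · rintro ⟨i, j⟩ - - h
    exact Fin.succAbove_ne i j (congrArg Prod.fst h)
  · simp
  · rintro ⟨i, j⟩ -
    exact Prod.ext (Fin.succAbove_succAbove_predAbove i j) (Fin.predAbove_predAbove_succAbove i j)

/-- The chain complex formed by submodules `M n` of the modules of elementary `n`-paths,
stable under `∂`. -/
noncomputable def subcomplex (M : ∀ n, Submodule R (Tuples R V n))
    (hM : ∀ n, ∀ a ∈ M (n + 1), boundary R n a ∈ M n) : ChainComplex (ModuleCat.{max u v} R) ℕ :=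
  ChainComplex.of (fun n => ModuleCat.of R (M n))
    (fun n => ModuleCat.ofHom ((boundary R n).restrict (hM n)))
    (fun n => by
      refine ModuleCat.hom_ext (LinearMap.ext fun a => Subtype.ext ?_)
      exact boundary_boundary R n a.1)

end Chains

section OrderedComplex

variable {V : Type v}

/-- An ordered simplicial complex: the `n`-simplices are tuples `(x_0, …, x_n)` of distinct
vertices, and forgetting an entry of a simplex gives a simplex. -/
structure OrderedComplex (V : Type v) where
  simplices : ∀ n : ℕ, Set (Fin (n + 1) → V)
  injective : ∀ n, ∀ x ∈ simplices n, Function.Injective x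
  face_mem : ∀ n, ∀ x ∈ simplices (n + 1), ∀ i, face i x ∈ simplices n

variable (R : Type u) [CommRing R]

lemma OrderedComplex.boundary_mem (K : OrderedComplex V) (n : ℕ) (a : Tuples R V (n + 1))
    (ha : a ∈ Finsupp.supported R R (K.simplices (n + 1))) :
    boundary R n a ∈ Finsupp.supported R R (K.simplices n) := by
  rw [boundary, signedFaces, Finsupp.linearCombination_apply]
  refine Submodule.sum_mem _ fun x hx => Submodule.smul_mem _ _ <|
    Submodule.sum_mem _ fun i _ => Submodule.smul_mem _ _ ?_
  exact Finsupp.single_mem_supported R 1 (K.face_mem n x (ha hx) i)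

/-- The simplicial chain complex of an ordered simplicial complex: in degree `n` the free module
on the `n`-simplices, with the alternating sum of the face maps as differential. -/
noncomputable def OrderedComplex.chains (K : OrderedComplex V) :
    ChainComplex (ModuleCat.{max u v} R) ℕ :=
  subcomplex R (fun n => Finsupp.supported R R (K.simplices n)) (K.boundary_mem R)

end OrderedComplex

section Digraphs

variable {V : Type v} (G : Digraph V)

/-- `HasWalk G n x y`: there is a directed path with `n` edges from `x` to `y` in `G`. -/
inductive HasWalk : ℕ → V → V → Prop
  | nil (x : V) : HasWalk 0 x x
  | cons {n : ℕ} {x y z : V} : G.Adj x y → HasWalk n y z → HasWalk (n + 1) x z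

/-- There is a directed path from `x` to `y`, possibly the constant one. -/
def Reaches (x y : V) : Prop := ∃ n, HasWalk G n x y

/-- The directed path distance: the least number of edges of a directed path from `x` to `y`,
and `∞` if there is none. -/
noncomputable def dist (x y : V) : ℕ∞ := ⨅ (n : ℕ) (_ : HasWalk G n x y), (n : ℕ∞)

/-- The length of a tuple of vertices; it is finite iff all the consecutive distances are. -/
noncomputable def len {n : ℕ} (x : Fin (n + 1) → V) : ℕ∞ :=
  ∑ i : Fin n, dist G (x i.castSucc) (x i.succ)

/-- The complex of injective words on `G`. -/
def injWords : OrderedComplex V where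
  simplices _ := {x | Function.Injective x ∧ ∀ i j, i < j → Reaches G (x i) (x j)}
  injective _ _ hx := hx.1
  face_mem _ _ hx i := ⟨hx.1.comp Fin.succAbove_right_injective,
    fun _ _ hjk => hx.2 _ _ (Fin.strictMono_succAbove i hjk)⟩

/-- The directed flag complex of `G`: its `n`-simplices are the ordered `(n+1)`-cliques. -/
def dirFlag : OrderedComplex V where
  simplices _ := {x | Function.Injective x ∧ ∀ i j, i < j → G.Adj (x i) (x j)}
  injective _ _ hx := hx.1
  face_mem _ _ hx i := ⟨hx.1.comp Fin.succAbove_right_injective,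
    fun _ _ hjk => hx.2 _ _ (Fin.strictMono_succAbove i hjk)⟩

/-- The reachability preorder of `G`, viewed as a directed graph. -/
def reachPre : Digraph V where
  Adj x y := Reaches G x y

/-- The strongly regular allowed elementary `n`-paths of `G`: tuples of distinct vertices such
that any two consecutive ones span a directed edge. -/
def allowedPaths (n : ℕ) : Set (Fin (n + 1) → V) :=
  {x | Function.Injective x ∧ ∀ i : Fin n, G.Adj (x i.castSucc) (x i.succ)}

/-- The generators of the eulerian magnitude chains in bidegree `(k, l)`: tuples of distinct
vertices of length `l`. -/
def eulerianTuples (k l : ℕ) : Set (Fin (k + 1) → V) :=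
  {x | Function.Injective x ∧ len G x = l}

variable (R : Type u) [CommRing R]

/-- The `∂`-invariant strongly regular allowed `n`-paths: linear combinations `a` of strongly
regular allowed paths such that `∂ a` is again such a combination. -/
noncomputable def regularPaths : ∀ n, Submodule R (Tuples R V n)
  | 0 => Finsupp.supported R R (allowedPaths G 0)
  | n + 1 => Finsupp.supported R R (allowedPaths G (n + 1)) ⊓
      (Finsupp.supported R R (allowedPaths G n)).comap (boundary R n)

lemma boundary_mem_regularPaths (n : ℕ) (a : Tuples R V (n + 1))
    (ha : a ∈ regularPaths G R (n + 1)) : boundary R n a ∈ regularPaths G R n := by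
  cases n with
  | zero => exact ha.2
  | succ n =>
    refine ⟨ha.2, ?_⟩
    change boundary R n (boundary R (n + 1) a) ∈ Finsupp.supported R R (allowedPaths G n)
    rw [boundary_boundary]
    exact Submodule.zero_mem _

/-- The chain complex computing regular path homology. -/
noncomputable def regularPathComplex : ChainComplex (ModuleCat.{max u v} R) ℕ :=
  subcomplex R (regularPaths G R) (boundary_mem_regularPaths G R)

/-- The magnitude differential `∑_{i=1}^{k} (-1)^i ∂_i` from bidegree `(k+1, l)` to `(k, l)`:
only inner entries are forgotten, and faces whose length is not `l` are replaced by `0`. -/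
noncomputable def eulerianBoundary (l k : ℕ) :
    Finsupp.supported R R (eulerianTuples G (k + 1) l) →ₗ[R]
      Finsupp.supported R R (eulerianTuples G k l) :=
  letI := Classical.decPred (· ∈ eulerianTuples G k l)
  Finsupp.restrictDom R R (eulerianTuples G k l) ∘ₗ
    signedFaces R (Finset.univ.filter fun i => i ≠ 0 ∧ i ≠ Fin.last (k + 1)) ∘ₗ
    (Finsupp.supported R R (eulerianTuples G (k + 1) l)).subtype

lemma HasWalk.trans {m n : ℕ} {x y z : V} (h : HasWalk G m x y) (h' : HasWalk G n y z) :
    HasWalk G (m + n) x z := by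
  induction h with
  | nil => simpa using h'
  | cons ha _ ih => rw [Nat.add_right_comm]; exact .cons ha (ih h')

lemma exists_hasWalk {x y : V} (h : dist G x y ≠ ⊤) : ∃ n, HasWalk G n x y ∧ dist G x y = n := by
  classical
  have hex : ∃ n, HasWalk G n x y := by
    by_contra hc
    push Not at hc
    exact h (by simp [dist, hc])
  refine ⟨Nat.find hex, Nat.find_spec hex, le_antisymm ?_ ?_⟩
  · exact iInf₂_le (f := fun (n : ℕ) (_ : HasWalk G n x y) => (n : ℕ∞)) _ (Nat.find_spec hex)
  · exact le_iInf₂ fun n hn => by exact_mod_cast Nat.find_min' hex hn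

lemma dist_triangle (x y z : V) : dist G x z ≤ dist G x y + dist G y z := by
  by_cases h : dist G x y = ⊤
  · simp [h]
  by_cases h' : dist G y z = ⊤
  · simp [h']
  obtain ⟨m, hm, hm'⟩ := exists_hasWalk G h
  obtain ⟨n, hn, hn'⟩ := exists_hasWalk G h'
  rw [hm', hn']
  exact_mod_cast iInf₂_le (f := fun (n : ℕ) (_ : HasWalk G n x z) => (n : ℕ∞))
    (m + n) (hm.trans G hn)

lemma dist_pos {x y : V} (h : x ≠ y) : 0 < dist G x y := by
  rw [pos_iff_ne_zero]
  intro h0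
  obtain ⟨n, hn, hn'⟩ := exists_hasWalk G (x := x) (y := y) (by simp [h0])
  rw [h0] at hn'
  obtain rfl : n = 0 := by exact_mod_cast hn'.symm
  cases hn
  exact h rfl

lemma len_succ {n : ℕ} (x : Fin (n + 2) → V) :
    len G x = dist G (x 0) (x 1) + len G (face 0 x) := by
  simp [len, Fin.sum_univ_succ, face]

lemma len_castSucc {n : ℕ} (x : Fin (n + 2) → V) :
    len G x = len G (face (Fin.last _) x) +
      dist G (x (Fin.last n).castSucc) (x (Fin.last (n + 1))) := by
  simp [len, Fin.sum_univ_castSucc, face]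

lemma len_face_le {n : ℕ} (i : Fin (n + 2)) (x : Fin (n + 2) → V) :
    len G (face i x) ≤ len G x := by
  induction n with
  | zero => simp [len]
  | succ n ih =>
    refine Fin.cases ?_ (fun j => ?_) i
    · rw [len_succ G x]
      exact le_add_self
    · have key : face 0 (face j.succ x) = face j (face 0 x) := by
        funext k
        simp [face]
      rw [len_succ G x, len_succ G (face j.succ x), key]
      refine Fin.cases ?_ (fun j => ?_) j
      · rw [len_succ G (face 0 x), ← add_assoc]
        gcongr
        exact dist_triangle G _ _ _
      · exact add_le_add le_rfl (ih _ _)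

lemma len_face_lt {n l : ℕ} {x : Fin (n + 2) → V} (hx : x ∈ eulerianTuples G (n + 1) l)
    {i : Fin (n + 2)} (hi : ¬ (i ≠ 0 ∧ i ≠ Fin.last (n + 1))) : len G (face i x) < l := by
  obtain ⟨hinj, hl⟩ := hx
  refine lt_of_le_of_ne (hl ▸ len_face_le G i x) fun h => ?_
  rw [not_and_or, not_not, not_not] at hi
  rcases hi with rfl | rfl
  · have h1 := len_succ G x
    have h2 := dist_pos G (hinj.ne (show (0 : Fin (n + 2)) ≠ 1 by simp))
    rw [hl, h] at h1
    generalize dist G (x 0) (x 1) = d at *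
    cases d with
    | top => simp at h1
    | coe d => norm_cast at *; omega
  · have h1 := len_castSucc G x
    have h2 := dist_pos G (hinj.ne (Fin.castSucc_lt_last (Fin.last n)).ne)
    rw [hl, h] at h1
    generalize dist G (x (Fin.last n).castSucc) (x (Fin.last (n + 1))) = d at *
    cases d with
    | top => simp at h1
    | coe d => norm_cast at *; omega

open Classical in
lemma eulerianBoundary_eq (l k : ℕ) (a : Finsupp.supported R R (eulerianTuples G (k + 1) l)) :
    eulerianBoundary G R l k a =
      Finsupp.restrictDom R R (eulerianTuples G k l) (boundary R k a.1) := by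
  obtain ⟨a, ha⟩ := a
  simp only [eulerianBoundary, LinearMap.comp_apply, Submodule.subtype_apply, boundary, signedFaces,
    Finsupp.linearCombination_apply, Finsupp.sum, map_sum, map_smul]
  refine Finset.sum_congr rfl fun x hx => congrArg _ ?_
  convert Finset.sum_subset (Finset.subset_univ _) fun i _ hi => ?_
  rw [Finset.mem_filter_univ] at hi
  have hlt := len_face_lt G (ha hx) hi
  refine smul_eq_zero_of_right _ (Subtype.ext ?_)
  exact Finsupp.filter_single_of_neg _ fun hm => hlt.ne hm.2

open Classical in
lemma restrictDom_boundary_eq_zero (l k : ℕ) (c : Tuples R V (k + 1))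
    (hc : ∀ x ∈ c.support, len G x < l) :
    Finsupp.restrictDom R R (eulerianTuples G k l) (boundary R k c) = 0 := by
  simp only [boundary, signedFaces, Finsupp.linearCombination_apply, Finsupp.sum, map_sum, map_smul]
  refine Finset.sum_eq_zero fun x hx => smul_eq_zero_of_right _ <|
    Finset.sum_eq_zero fun i _ => smul_eq_zero_of_right _ (Subtype.ext ?_)
  exact Finsupp.filter_single_of_neg _
    fun hm => ((len_face_le G i x).trans_lt (hc x hx)).ne hm.2

lemma boundary_mem_len_le (l k : ℕ) (a : Tuples R V (k + 1))
    (ha : a ∈ Finsupp.supported R R (eulerianTuples G (k + 1) l)) :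
    boundary R k a ∈ Finsupp.supported R R {x | Function.Injective x ∧ len G x ≤ l} := by
  rw [boundary, signedFaces, Finsupp.linearCombination_apply]
  refine Submodule.sum_mem _ fun x hx => Submodule.smul_mem _ _ <|
    Submodule.sum_mem _ fun i _ => Submodule.smul_mem _ _ ?_
  exact Finsupp.single_mem_supported R 1 ⟨(ha hx).1.comp Fin.succAbove_right_injective,
    (len_face_le G i x).trans (ha hx).2.le⟩

lemma eulerianBoundary_comp (l k : ℕ) :
    eulerianBoundary G R l k ∘ₗ eulerianBoundary G R l (k + 1) = 0 := by
  classical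
  refine LinearMap.ext fun a => ?_
  rw [LinearMap.comp_apply, eulerianBoundary_eq, eulerianBoundary_eq, LinearMap.zero_apply]
  set b := boundary R (k + 1) a.1 with hb
  have hsplit : (Finsupp.restrictDom R R (eulerianTuples G (k + 1) l) b : Tuples R V (k + 1)) =
      b - b.filter (fun x => x ∉ eulerianTuples G (k + 1) l) :=
    eq_sub_of_add_eq (Finsupp.filter_add_filter_not b _)
  have hzero := restrictDom_boundary_eq_zero G R l k
    (b.filter (fun x => x ∉ eulerianTuples G (k + 1) l)) fun x hx => by
      rw [Finsupp.support_filter, Finset.mem_filter] at hx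
      have hx' := boundary_mem_len_le G R l (k + 1) a.1 a.2 hx.1
      exact lt_of_le_of_ne hx'.2 fun h => hx.2 ⟨hx'.1, h⟩
  rw [hsplit, map_sub, map_sub, hzero, hb, boundary_boundary, map_zero]
  exact sub_self _

/-- The eulerian magnitude chain complex `EMC_{*,l}(G)`. -/
noncomputable def eulerianComplex (l : ℕ) : ChainComplex (ModuleCat.{max u v} R) ℕ :=
  ChainComplex.of (fun k => ModuleCat.of R (Finsupp.supported R R (eulerianTuples G k l)))
    (fun k => ModuleCat.ofHom (eulerianBoundary G R l k))
    (fun k => by rw [← ModuleCat.ofHom_comp, eulerianBoundary_comp]; rfl)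

/-- `G` is regularly diagonal (over `R`): its eulerian magnitude homology `EMH_{k,l}(G)` vanishes
for all `k ≠ l`. -/
def RegularlyDiagonal : Prop :=
  ∀ k l : ℕ, k ≠ l → Limits.IsZero ((eulerianComplex G R l).homology k)

end Digraphs

end EulerianMagnitude

namespace EulerianMagnitude

universe u v

section HomologyIso

universe w

variable {R : Type u} [Ring R]

lemma exists_cycle {S : ShortComplex (ModuleCat.{w} R)} (x : S.X₂) (hx : S.g x = 0) :
    ∃ z : S.cycles, S.iCycles z = x :=
  ⟨S.moduleCatCyclesIso.inv ⟨x, hx⟩,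
    congrArg (fun f => (ConcreteCategory.hom f) ⟨x, hx⟩) S.moduleCatCyclesIso_inv_iCycles⟩

lemma homologyπ_eq_zero_iff {S : ShortComplex (ModuleCat.{w} R)} (z : S.cycles) :
    S.homologyπ z = 0 ↔ ∃ x : S.X₁, S.f x = S.iCycles z := by
  have hinj : Function.Injective S.homologyι := (ModuleCat.mono_iff_injective _).1 inferInstance
  have hcomp : S.homologyι (S.homologyπ z) = S.pOpcycles (S.iCycles z) := by
    rw [← ConcreteCategory.comp_apply, S.homology_π_ι, ConcreteCategory.comp_apply]
  rw [← map_eq_zero_iff _ hinj, hcomp, S.moduleCat_pOpcycles_eq_zero_iff]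
  rfl

lemma homologyMap_homologyπ {S T : ShortComplex (ModuleCat.{w} R)} (φ : S ⟶ T) (z : S.cycles) :
    ShortComplex.homologyMap φ (S.homologyπ z) = T.homologyπ (ShortComplex.cyclesMap φ z) := by
  rw [← ConcreteCategory.comp_apply, ShortComplex.homologyπ_naturality,
    ConcreteCategory.comp_apply]

lemma iCycles_cyclesMap {S T : ShortComplex (ModuleCat.{w} R)} (φ : S ⟶ T) (z : S.cycles) :
    T.iCycles (ShortComplex.cyclesMap φ z) = φ.τ₂ (S.iCycles z) := by
  rw [← ConcreteCategory.comp_apply, ShortComplex.cyclesMap_i, ConcreteCategory.comp_apply]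

/-- An elementwise criterion for a morphism of short complexes of modules to induce an isomorphism
in homology. -/
lemma isIso_homologyMap {S T : ShortComplex (ModuleCat.{w} R)} (φ : S ⟶ T)
    (hinj : ∀ x : S.X₂, S.g x = 0 → ∀ y : T.X₁, T.f y = φ.τ₂ x → ∃ x' : S.X₁, S.f x' = x)
    (hsurj : ∀ y : T.X₂, T.g y = 0 → ∃ x : S.X₂, S.g x = 0 ∧ ∃ y' : T.X₁, T.f y' = y - φ.τ₂ x) :
    IsIso (ShortComplex.homologyMap φ) := by
  have hπ : ∀ U : ShortComplex (ModuleCat.{w} R), Function.Surjective U.homologyπ := fun U =>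
    (ModuleCat.epi_iff_surjective _).1 inferInstance
  have hg : ∀ (U : ShortComplex (ModuleCat.{w} R)) (z : U.cycles), U.g (U.iCycles z) = 0 :=
    fun U z => by
      rw [← ConcreteCategory.comp_apply, U.iCycles_g]
      rfl
  rw [ConcreteCategory.isIso_iff_bijective]
  refine ⟨(injective_iff_map_eq_zero _).2 fun h hh => ?_, fun h => ?_⟩
  · obtain ⟨z, rfl⟩ := hπ _ h
    rw [homologyMap_homologyπ, homologyπ_eq_zero_iff, iCycles_cyclesMap] at hh
    obtain ⟨y, hy⟩ := hh
    exact (homologyπ_eq_zero_iff z).2 (hinj _ (hg _ z) y hy)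
  · obtain ⟨z, rfl⟩ := hπ _ h
    obtain ⟨x, hx, y, hy⟩ := hsurj _ (hg _ z)
    obtain ⟨w, rfl⟩ := exists_cycle x hx
    refine ⟨S.homologyπ w, ?_⟩
    rw [homologyMap_homologyπ, eq_comm, ← sub_eq_zero, ← map_sub, homologyπ_eq_zero_iff, map_sub,
      iCycles_cyclesMap]
    exact ⟨y, hy⟩

lemma isIso_homologyMap_of_elements {K L : ChainComplex (ModuleCat.{w} R) ℕ} (φ : K ⟶ L)
    {i j k : ℕ} (hi : (ComplexShape.down ℕ).prev j = i) (hk : (ComplexShape.down ℕ).next j = k)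
    (hinj : ∀ x : K.X j, K.d j k x = 0 → ∀ y : L.X i, L.d i j y = φ.f j x →
      ∃ x' : K.X i, K.d i j x' = x)
    (hsurj : ∀ y : L.X j, L.d j k y = 0 →
      ∃ x : K.X j, K.d j k x = 0 ∧ ∃ y' : L.X i, L.d i j y' = y - φ.f j x) :
    IsIso (HomologicalComplex.homologyMap φ j) := by
  subst hi hk
  exact isIso_homologyMap _ hinj hsurj

end HomologyIso

section Subcomplex

variable {R : Type u} [CommRing R] {V : Type v}

lemma boundary_mem_supported {n : ℕ} {S : Set (Fin (n + 2) → V)} {T : Set (Fin (n + 1) → V)}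
    (h : ∀ x ∈ S, ∀ i, face i x ∈ T) {a : Tuples R V (n + 1)}
    (ha : a ∈ Finsupp.supported R R S) : boundary R n a ∈ Finsupp.supported R R T := by
  rw [boundary, signedFaces, Finsupp.linearCombination_apply]
  refine Submodule.sum_mem _ fun x hx => Submodule.smul_mem _ _ <|
    Submodule.sum_mem _ fun i _ => Submodule.smul_mem _ _ ?_
  exact Finsupp.single_mem_supported R 1 (h x (ha hx) i)

variable {M N : ∀ n, Submodule R (Tuples R V n)}
  {hM : ∀ n, ∀ a ∈ M (n + 1), boundary R n a ∈ M n}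
  {hN : ∀ n, ∀ a ∈ N (n + 1), boundary R n a ∈ N n}

lemma subcomplex_d_apply (n : ℕ) (a : M (n + 1)) :
    (subcomplex R M hM).d (n + 1) n a = (⟨boundary R n a.1, hM n a.1 a.2⟩ : M n) := by
  dsimp only [subcomplex]
  rw [ChainComplex.of_d]
  rfl

/-- The inclusion of a subcomplex of elementary paths into a larger one. -/
noncomputable def subcomplexInclusion (h : ∀ n, M n ≤ N n) :
    subcomplex R M hM ⟶ subcomplex R N hN :=
  ChainComplex.ofHom (fun n => ModuleCat.ofHom (Submodule.inclusion (h n))) fun n => by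
    refine ModuleCat.hom_ext (LinearMap.ext fun a => ?_)
    change (subcomplex R N hN).d (n + 1) n (Submodule.inclusion (h (n + 1)) a) =
      Submodule.inclusion (h n) ((subcomplex R M hM).d (n + 1) n a)
    rw [subcomplex_d_apply]
    exact congrArg (Submodule.inclusion (h n)) (subcomplex_d_apply (hM := hM) n a).symm

/-- An inclusion of complexes of elementary paths is a quasi-isomorphism as soon as every chain of
the larger complex with boundary in the smaller one is, up to a boundary, in the smaller one. -/
lemma isIso_homologyMap_subcomplexInclusion (h : ∀ n, M n ≤ N n)
    (h₀ : ∀ c ∈ N 0, ∃ b ∈ N 1, c - boundary R 0 b ∈ M 0)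
    (h₁ : ∀ n, ∀ c ∈ N (n + 1), boundary R n c ∈ M n →
      ∃ b ∈ N (n + 2), c - boundary R (n + 1) b ∈ M (n + 1)) (n : ℕ) :
    IsIso (HomologicalComplex.homologyMap
      (subcomplexInclusion h : subcomplex R M hM ⟶ subcomplex R N hN) n) := by
  have hinj : ∀ (m : ℕ) (a : M m) (c : N (m + 1)),
      (subcomplex R N hN).d (m + 1) m c = Submodule.inclusion (h m) a →
      ∃ b : M (m + 1), (subcomplex R M hM).d (m + 1) m b = a := by
    intro m a c hc
    have hc' : boundary R m c.1 = a.1 :=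
      congrArg Subtype.val ((subcomplex_d_apply (hM := hN) m c).symm.trans hc)
    obtain ⟨b, -, hb⟩ := h₁ m c.1 c.2 (by rw [hc']; exact a.2)
    refine ⟨⟨_, hb⟩, (subcomplex_d_apply m _).trans (Subtype.ext ?_)⟩
    change boundary R m (c.1 - boundary R (m + 1) b) = a.1
    rw [map_sub, boundary_boundary, hc', sub_zero]
  have hdiff : ∀ (m : ℕ) (c : N m) (b : Tuples R V (m + 1)) (hb : b ∈ N (m + 1))
      (hcb : c.1 - boundary R m b ∈ M m),
      (subcomplex R N hN).d (m + 1) m (⟨b, hb⟩ : N (m + 1)) =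
        c - Submodule.inclusion (h m) ⟨_, hcb⟩ := fun m c b hb hcb =>
    (subcomplex_d_apply (hM := hN) m ⟨b, hb⟩).trans
      (Subtype.ext (sub_sub_cancel c.1 (boundary R m b)).symm)
  cases n with
  | zero =>
    have hd : (subcomplex R M hM).d 0 0 = 0 := (subcomplex R M hM).shape _ _ (by simp)
    refine isIso_homologyMap_of_elements (i := 1) (k := 0) _ (by simp) (by simp)
      (fun a _ c hc => hinj 0 a c hc) fun c _ => ?_
    obtain ⟨b, hb, hcb⟩ := h₀ (Subtype.val (p := (· ∈ N 0)) c) (Subtype.property (p := (· ∈ N 0)) c)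
    exact ⟨(⟨_, hcb⟩ : M 0), by rw [hd]; rfl, (⟨b, hb⟩ : N 1), hdiff 0 c b hb hcb⟩
  | succ n =>
    refine isIso_homologyMap_of_elements (i := n + 2) (k := n) _ (by simp) (by simp)
      (fun a _ c hc => hinj (n + 1) a c hc) fun (c : N (n + 1)) hc => ?_
    have hc' : boundary R n c.1 = 0 :=
      congrArg Subtype.val ((subcomplex_d_apply (hM := hN) n c).symm.trans hc)
    obtain ⟨b, hb, hcb⟩ := h₁ n c.1 c.2 (by rw [hc']; exact Submodule.zero_mem _)
    refine ⟨(⟨_, hcb⟩ : M (n + 1)), (subcomplex_d_apply n _).trans (Subtype.ext ?_),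
      (⟨b, hb⟩ : N (n + 2)), hdiff (n + 1) c b hb hcb⟩
    change boundary R n (c.1 - boundary R (n + 1) b) = 0
    rw [map_sub, boundary_boundary, hc', sub_zero]

end Subcomplex

section LengthFiltration

variable {V : Type v} (G : Digraph V)

/-- The tuples of `n + 1` distinct vertices of length at most `l`. -/
def lenLE (n l : ℕ) : Set (Fin (n + 1) → V) :=
  {x | Function.Injective x ∧ len G x ≤ l}

lemma face_mem_lenLE {n l : ℕ} {x : Fin (n + 2) → V} (hx : x ∈ lenLE G (n + 1) l)
    (i : Fin (n + 2)) : face i x ∈ lenLE G n l :=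
  ⟨hx.1.comp Fin.succAbove_right_injective, (len_face_le G i x).trans hx.2⟩

lemma lenLE_mono {n l m : ℕ} (h : l ≤ m) : lenLE G n l ⊆ lenLE G n m := fun _ hx =>
  ⟨hx.1, hx.2.trans (by exact_mod_cast h)⟩

lemma dist_ne_top_iff {x y : V} : dist G x y ≠ ⊤ ↔ Reaches G x y := by
  refine ⟨fun h => ?_, fun ⟨n, hn⟩ h => ?_⟩
  · obtain ⟨n, hn, -⟩ := exists_hasWalk G h
    exact ⟨n, hn⟩
  · have := iInf₂_le (f := fun (n : ℕ) (_ : HasWalk G n x y) => (n : ℕ∞)) n hn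
    exact absurd (h.symm.trans_le this) (by simp)

lemma dist_le_one_iff {x y : V} (hxy : x ≠ y) : dist G x y ≤ 1 ↔ G.Adj x y := by
  refine ⟨fun h => ?_, fun h => ?_⟩
  · obtain ⟨n, hn, hd⟩ := exists_hasWalk G (x := x) (y := y) fun ht => by simp [ht] at h
    rw [hd] at h
    have hn1 : n ≤ 1 := by exact_mod_cast h
    cases hn with
    | nil => exact absurd rfl hxy
    | cons ha hw =>
      cases hw with
      | nil => exact ha
      | cons => omega
  · exact_mod_cast iInf₂_le (f := fun (n : ℕ) (_ : HasWalk G n x y) => (n : ℕ∞)) 1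
      (.cons h (.nil y))

lemma dist_le_len {n : ℕ} (x : Fin (n + 1) → V) (i : Fin n) :
    dist G (x i.castSucc) (x i.succ) ≤ len G x :=
  Finset.single_le_sum (f := fun i : Fin n => dist G (x i.castSucc) (x i.succ))
    (fun _ _ => zero_le) (Finset.mem_univ i)

lemma len_ne_top_iff {n : ℕ} (x : Fin (n + 1) → V) :
    len G x ≠ ⊤ ↔ ∀ i j, i < j → Reaches G (x i) (x j) := by
  have : IsTrans V (Reaches G) := ⟨fun _ _ _ ⟨m, hm⟩ ⟨n, hn⟩ => ⟨m + n, hm.trans G hn⟩⟩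
  have key := Fin.liftFun_iff_succ (Reaches G) (f := x)
  refine Iff.trans ⟨fun h i => ?_, fun h ht => ?_⟩ key.symm
  · exact (dist_ne_top_iff G).1 (ne_top_of_le_ne_top h (dist_le_len G x i))
  · obtain ⟨i, -, hi⟩ := ENat.sum_eq_top.1 ht
    exact (dist_ne_top_iff G).2 (h i) hi

lemma lenLE_self (n : ℕ) : lenLE G n n = allowedPaths G n := by
  ext x
  refine and_congr_right fun hx => ?_
  have hne : ∀ i : Fin n, x i.castSucc ≠ x i.succ := fun i => hx.ne Fin.castSucc_lt_succ.ne
  refine ⟨fun h i => (dist_le_one_iff G (hne i)).1 ?_, fun h => ?_⟩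
  · have hfin : ∀ i : Fin n, ∃ m : ℕ, dist G (x i.castSucc) (x i.succ) = m := fun i =>
      ENat.ne_top_iff_exists.1 (ne_top_of_le_ne_top (ENat.natCast_ne_top n)
        ((dist_le_len G x i).trans h)) |>.imp fun _ h => h.symm
    choose m hm using hfin
    have hpos : ∀ i, 1 ≤ m i := fun i => by
      have := dist_pos G (hne i)
      rw [hm i] at this
      exact_mod_cast this
    have hsum : ∑ i, m i ≤ n := by
      have h' := h
      simp only [len, hm] at h'
      exact_mod_cast h'
    rw [hm i]
    by_contra hlt
    have hlt' : 1 < m i := by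
      rw [not_le] at hlt
      exact_mod_cast hlt
    have := Finset.sum_lt_sum (s := Finset.univ) (fun i _ => hpos i) ⟨i, Finset.mem_univ i, hlt'⟩
    simp only [Finset.sum_const, Finset.card_univ, Fintype.card_fin, smul_eq_mul, mul_one] at this
    omega
  · refine (Finset.sum_le_sum fun i _ => (dist_le_one_iff G (hne i)).2 (h i)).trans ?_
    simp

lemma lenLE_subset_injWords (n l : ℕ) : lenLE G n l ⊆ (injWords G).simplices n := fun x hx =>
  ⟨hx.1, (len_ne_top_iff G x).1 (ne_top_of_le_ne_top (ENat.natCast_ne_top l) hx.2)⟩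

variable {R : Type u} [CommRing R]

lemma exists_mem_supported_lenLE {n : ℕ} {c : Tuples R V n}
    (hc : c ∈ Finsupp.supported R R ((injWords G).simplices n)) :
    ∃ l, c ∈ Finsupp.supported R R (lenLE G n l) := by
  refine ⟨c.support.sup fun x => (len G x).toNat, fun x hx => ⟨(hc hx).1, ?_⟩⟩
  rw [← ENat.natCast_toNat ((len_ne_top_iff G x).2 (hc hx).2)]
  exact_mod_cast Finset.le_sup (f := fun x => (len G x).toNat) hx

lemma boundary_mem_lenLE {n l : ℕ} {c : Tuples R V (n + 1)}
    (hc : c ∈ Finsupp.supported R R (lenLE G (n + 1) l)) :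
    boundary R n c ∈ Finsupp.supported R R (lenLE G n l) :=
  boundary_mem_supported (fun _ hx => face_mem_lenLE G hx) hc

open Classical in
lemma restrictDom_eq_zero_iff {n l : ℕ} {c : Tuples R V n}
    (hc : c ∈ Finsupp.supported R R (lenLE G n (l + 1))) :
    Finsupp.restrictDom R R (eulerianTuples G n (l + 1)) c = 0 ↔
      c ∈ Finsupp.supported R R (lenLE G n l) := by
  refine Subtype.ext_iff.trans (Finsupp.filter_eq_zero_iff _ _ |>.trans ⟨fun h x hx => ?_,
    fun h x hx => ?_⟩)
  · refine ⟨(hc hx).1, Order.lt_add_one_iff_of_not_isMax (by simp) |>.1 (lt_of_le_of_ne ?_ ?_)⟩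
    · exact_mod_cast (hc hx).2
    · exact fun he => Finsupp.mem_support_iff.1 hx (h x ⟨(hc hx).1, by exact_mod_cast he⟩)
  · by_contra hx'
    have := (h (Finsupp.mem_support_iff.2 hx')).2
    rw [hx.2] at this
    have : l + 1 ≤ l := by exact_mod_cast this
    omega

lemma RegularlyDiagonal.exists_eulerianBoundary_eq (hG : RegularlyDiagonal G R) {k l : ℕ}
    (hkl : k + 1 ≠ l) (a : Finsupp.supported R R (eulerianTuples G (k + 1) l))
    (ha : eulerianBoundary G R l k a = 0) : ∃ b, eulerianBoundary G R l (k + 1) b = a := by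
  have hex := (HomologicalComplex.exactAt_iff_isZero_homology _ _).2 (hG (k + 1) l hkl)
  rw [HomologicalComplex.exactAt_iff' _ (k + 2) (k + 1) k (by simp) (by simp),
    ShortComplex.moduleCat_exact_iff] at hex
  have hd : ∀ m, (eulerianComplex G R l).d (m + 1) m =
      ModuleCat.ofHom (eulerianBoundary G R l m) := fun m => by
    dsimp only [eulerianComplex]
    rw [ChainComplex.of_d]
  obtain ⟨b, hb⟩ := hex a (by
    change (eulerianComplex G R l).d (k + 1) k a = 0
    rw [hd]
    exact ha)
  refine ⟨b, Eq.trans ?_ hb⟩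
  change _ = (eulerianComplex G R l).d (k + 2) (k + 1) b
  rw [hd]
  rfl

/-- For a regularly diagonal digraph, a chain above the diagonal whose boundary has smaller length
can be shortened by a boundary. -/
lemma RegularlyDiagonal.exists_sub_boundary_mem_lenLE (hG : RegularlyDiagonal G R) {k l : ℕ}
    (hkl : k + 1 ≤ l) {c : Tuples R V (k + 1)}
    (hc : c ∈ Finsupp.supported R R (lenLE G (k + 1) (l + 1)))
    (hbc : boundary R k c ∈ Finsupp.supported R R (lenLE G k l)) :
    ∃ b ∈ Finsupp.supported R R (lenLE G (k + 2) (l + 1)),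
      c - boundary R (k + 1) b ∈ Finsupp.supported R R (lenLE G (k + 1) l) := by
  classical
  have hle : ∀ n, Finsupp.supported R R (eulerianTuples G n (l + 1)) ≤
      Finsupp.supported R R (lenLE G n (l + 1)) := fun n =>
    Finsupp.supported_mono fun x hx => ⟨hx.1, hx.2.le⟩
  have hidem : ∀ a : Finsupp.supported R R (eulerianTuples G (k + 1) (l + 1)),
      Finsupp.restrictDom R R (eulerianTuples G (k + 1) (l + 1)) a.1 = a := fun a =>
    LinearMap.congr_fun (Finsupp.restrictDom_comp_subtype _) a
  set a := Finsupp.restrictDom R R (eulerianTuples G (k + 1) (l + 1)) c with ha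
  have hca : c - a.1 ∈ Finsupp.supported R R (lenLE G (k + 1) l) := by
    rw [← restrictDom_eq_zero_iff G (Submodule.sub_mem _ hc (hle _ a.2)), map_sub, hidem, ← ha,
      sub_self]
  have ha0 : eulerianBoundary G R (l + 1) k a = 0 := by
    rw [eulerianBoundary_eq, restrictDom_eq_zero_iff G (boundary_mem_lenLE G (hle _ a.2))]
    have := Submodule.sub_mem _ hbc (boundary_mem_lenLE G hca)
    rwa [map_sub, sub_sub_cancel] at this
  obtain ⟨b, hb⟩ := hG.exists_eulerianBoundary_eq G (by omega) a ha0
  refine ⟨b.1, hle _ b.2, ?_⟩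
  rw [← restrictDom_eq_zero_iff G
    (Submodule.sub_mem _ hc (boundary_mem_lenLE G (hle _ b.2))), map_sub, ← eulerianBoundary_eq,
    hb, sub_self]

lemma RegularlyDiagonal.exists_sub_boundary_mem_allowedPaths (hG : RegularlyDiagonal G R) {k : ℕ}
    {c : Tuples R V (k + 1)}
    (hc : c ∈ Finsupp.supported R R ((injWords G).simplices (k + 1)))
    (hbc : boundary R k c ∈ Finsupp.supported R R (lenLE G k (k + 1))) :
    ∃ b ∈ Finsupp.supported R R ((injWords G).simplices (k + 2)),
      c - boundary R (k + 1) b ∈ Finsupp.supported R R (allowedPaths G (k + 1)) := by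
  rw [← lenLE_self]
  have key : ∀ (m : ℕ) (c : Tuples R V (k + 1)),
      c ∈ Finsupp.supported R R (lenLE G (k + 1) (k + 1 + m)) →
      boundary R k c ∈ Finsupp.supported R R (lenLE G k (k + 1)) →
      ∃ b ∈ Finsupp.supported R R ((injWords G).simplices (k + 2)),
        c - boundary R (k + 1) b ∈ Finsupp.supported R R (lenLE G (k + 1) (k + 1)) := by
    intro m
    induction m with
    | zero => exact fun c hc _ => ⟨0, Submodule.zero_mem _, by simpa using hc⟩
    | succ m ih =>
      intro c hc hbc
      obtain ⟨b, hb, hcb⟩ := hG.exists_sub_boundary_mem_lenLE G (Nat.le_add_right (k + 1) m) hc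
        (Finsupp.supported_mono (lenLE_mono G (Nat.le_add_right (k + 1) m)) hbc)
      obtain ⟨b', hb', hcb'⟩ := ih _ hcb (by rwa [map_sub, boundary_boundary, sub_zero])
      refine ⟨b + b', Submodule.add_mem _
        (Finsupp.supported_mono (lenLE_subset_injWords G _ _) hb) hb', ?_⟩
      rwa [map_add, ← sub_sub]
  obtain ⟨l, hl⟩ := exists_mem_supported_lenLE G hc
  exact key l c (Finsupp.supported_mono (lenLE_mono G (by omega)) hl) hbc

lemma regularPaths_le_allowedPaths (n : ℕ) :
    regularPaths G R n ≤ Finsupp.supported R R (allowedPaths G n) := by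
  cases n with
  | zero => exact le_rfl
  | succ n => exact inf_le_left

lemma regularPaths_le_injWords (n : ℕ) :
    regularPaths G R n ≤ Finsupp.supported R R ((injWords G).simplices n) :=
  (regularPaths_le_allowedPaths G n).trans
    (Finsupp.supported_mono (lenLE_self G n ▸ lenLE_subset_injWords G n n))

/-- For a regularly diagonal digraph, the inclusion of the regular path complex into the chains of
the complex of injective words is a quasi-isomorphism. -/
theorem RegularlyDiagonal.isIso_homologyMap (hG : RegularlyDiagonal G R) (n : ℕ) :
    IsIso (HomologicalComplex.homologyMap
      (subcomplexInclusion (regularPaths_le_injWords G) :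
        regularPathComplex G R ⟶ (injWords G).chains R) n) := by
  refine isIso_homologyMap_subcomplexInclusion _ (fun c hc => ⟨0, Submodule.zero_mem _, ?_⟩)
    (fun n c hc hbc => ?_) n
  · rw [map_zero, sub_zero]
    exact fun x hx => ⟨(hc hx).1, fun i => i.elim0⟩
  · have hbc' := regularPaths_le_allowedPaths G n hbc
    have hle := Finsupp.supported_mono (R := R) (M := R) (lenLE_mono G (n := n) n.le_succ)
    obtain ⟨b, hb, hcb⟩ := hG.exists_sub_boundary_mem_allowedPaths G hc
      (hle (by rwa [lenLE_self]))
    refine ⟨b, hb, hcb, ?_⟩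
    change boundary R n (c - boundary R (n + 1) b) ∈ Finsupp.supported R R (allowedPaths G n)
    rwa [map_sub, boundary_boundary, sub_zero]

end LengthFiltration

end EulerianMagnitude

theorem mainTheorem3 {R : Type*} [CommRing R] {V : Type*} [Finite V] (G : Digraph V)
    (hconn : G.toSimpleGraphInclusive.Connected)
    (hdiag : EulerianMagnitude.RegularlyDiagonal G R) (n : ℕ) :
    Nonempty ((EulerianMagnitude.regularPathComplex G R).homology n ≅
        ((EulerianMagnitude.injWords G).chains R).homology n) ∧
      Nonempty ((EulerianMagnitude.regularPathComplex G R).homology n ≅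
        ((EulerianMagnitude.dirFlag (EulerianMagnitude.reachPre G)).chains R).homology n) := by
  have := hdiag.isIso_homologyMap G n
  exact ⟨⟨@asIso _ _ _ _ _ this⟩, ⟨@asIso _ _ _ _ _ this⟩⟩
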